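/- Let $\mathbb F$ be a finite-dimensional unital associative real algebra and let $V \neq 0$ be a finite-dimensional free left $\mathbb F$-module. Call $u \in V$ a good point if there is an $\mathbb F$-basis of $V$ in which the coordinates $u_1,\dots,u_n$ of $u$ satisfy $u_1\mathbb F + \cdots + u_n\mathbb F = \mathbb F$; the set $V^\bullet$ of good points is an open subset of $V$, stable under multiplication by the unit group $\mathbb F^\times$. Let $\mathbb P_{\mathbb F}(V) := V^\bullet/\mathbb F^\times$ with the quotient topology. Then the action of the Lie group $\mathbb F^\times$ on $V^\bullet$ is free and proper, and $\mathbb P_{\mathbb F}(V)$ is Hausdorff and second countable and carries the structure of a smooth ($C^\infty$) manifold of dimension $\dim_{\mathbb R} V - \dim_{\mathbb R}\mathbb F$ for which the quotient map $V^\bullet \to \mathbb P_{\mathbb F}(V)$ is a smooth principal $\mathbb F^\times$-bundle: the action of $\mathbb F^\times$ on $V^\bullet$ is smooth, the quotient map is smooth, and every point of $\mathbb P_{\mathbb F}(V)$ has an open neighbourhood $U$ over which there is an $\mathbb F^\times$-equivariant diffeomorphism from the preimage of $U$ onto $U \times \mathbb F^\times$, compatible with the projections to $U$, where $\mathbb F^\times$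 acts on $U\times\mathbb F^\times$ by left translation of the second factor. -/

import Mathlib

open scoped Manifold ContDiff

namespace AlgProj

/-- A finite-dimensional normed real algebra is complete, so that `Units` of it is a Lie group. -/
instance instCompleteSpaceAlg (F : Type*) [NormedRing F] [NormedAlgebra ℝ F]
    [FiniteDimensional ℝ F] : CompleteSpace F :=
  FiniteDimensional.complete ℝ F

/-- `u` is a good point of the left `F`-module `V` if in some basis its coordinates
`u₁, …, uₙ` satisfy `u₁ F + ⋯ + uₙ F = F`, i.e. every `a : F` is of the form `∑ uᵢ vᵢ`. -/
def IsGoodPoint (F : Type*) {V : Type*} [Ring F] [AddCommGroup V] [Module F V] (u : V) : Prop :=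
  ∃ (n : ℕ) (b : Module.Basis (Fin n) F V),
    ∀ a : F, ∃ v : Fin n → F, ∑ i, b.repr u i * v i = a

theorem IsGoodPoint.units_smul {F V : Type*} [Ring F] [AddCommGroup V] [Module F V]
    {u : V} (hu : IsGoodPoint F u) (α : Fˣ) : IsGoodPoint F (α • u) := by
  obtain ⟨n, b, h⟩ := hu
  refine ⟨n, b, fun a => ?_⟩
  obtain ⟨v, hv⟩ := h ((α⁻¹ : Fˣ) * a)
  refine ⟨v, ?_⟩
  have : ∀ i, b.repr (α • u) i = α * b.repr u i := fun i => by simp [Units.smul_def]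
  simp only [this, mul_assoc, ← Finset.mul_sum, hv, Units.mul_inv_cancel_left]

section

variable (F V : Type*) [NormedRing F] [NormedAlgebra ℝ F] [FiniteDimensional ℝ F]
  [NormedAddCommGroup V] [NormedSpace ℝ V] [Module F V] [IsScalarTower ℝ F V]

theorem isOpen_setOf_isGoodPoint : IsOpen {u : V | IsGoodPoint F u} := by
  rw [isOpen_iff_mem_nhds]
  rintro u ⟨n, b, h⟩
  obtain ⟨v, hv⟩ := h 1
  have : Module.Finite F V := Module.Finite.of_basis b
  have : FiniteDimensional ℝ V := Module.Finite.trans F V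
  let f : V →ₗ[ℝ] F :=
    { toFun := fun x => ∑ i, b.repr x i * v i
      map_add' := fun x y => by simp [add_mul, Finset.sum_add_distrib]
      map_smul' := fun c x => by
        have : ∀ i, b.repr (c • x) i = c • b.repr x i := fun i => by
          rw [← one_smul F x, ← smul_assoc, map_smul]; simp
        simp [this, Finset.smul_sum] }
  have hf : Continuous f := f.continuous_of_finiteDimensional
  have hU : {x : V | IsUnit (f x)} ∈ nhds u := by
    refine (Units.isOpen.preimage hf).mem_nhds ?_
    change IsUnit (f u)
    rw [show f u = 1 from hv]
    exact isUnit_one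
  filter_upwards [hU] with x hx
  obtain ⟨w, hw⟩ := hx
  refine ⟨n, b, fun a => ⟨fun i => v i * ((w⁻¹ : Fˣ) * a), ?_⟩⟩
  have hw' : ∑ i, b.repr x i * v i = w := hw.symm
  simp only [← mul_assoc, ← Finset.sum_mul, hw', Units.mul_inv, one_mul]

/-- The good points `V^•`, as an open subset (hence an open submanifold) of `V`. -/
def goodPoints : TopologicalSpace.Opens V :=
  ⟨{u : V | IsGoodPoint F u}, isOpen_setOf_isGoodPoint F V⟩

/-- The action of the unit group `F^×` on `V^•` by scalar multiplication. -/
instance instMulActionGoodPoints : MulAction Fˣ (goodPoints F V) where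
  smul α u := ⟨α • (u : V), IsGoodPoint.units_smul u.2 α⟩
  one_smul u := Subtype.ext (one_smul Fˣ (u : V))
  mul_smul α β u := Subtype.ext (mul_smul α β (u : V))

/-- The projective space `P_F(V) = V^• / F^×`, which carries the quotient topology. -/
abbrev ProjSpace : Type _ := Quotient (MulAction.orbitRel Fˣ (goodPoints F V))

/-- The quotient map `V^• → P_F(V)`. -/
def proj : goodPoints F V → ProjSpace F V := Quotient.mk _

end

/-- `π : E → B` is a smooth principal `G`-bundle, for a Lie group `G` acting on the left on `E`:
the action is smooth, `π` is smooth and `G`-invariant, and near every point `b` of `B` there is a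
smooth `G`-equivariant local trivialization `e : π⁻¹(U) ≃ U × G` over `U = e.baseSet`, where `G`
acts on `U × G` by left translation of the second factor. -/
structure IsSmoothPrincipalBundle
    {EG HG EE HE EB HB : Type*}
    [NormedAddCommGroup EG] [NormedSpace ℝ EG] [TopologicalSpace HG]
    [NormedAddCommGroup EE] [NormedSpace ℝ EE] [TopologicalSpace HE]
    [NormedAddCommGroup EB] [NormedSpace ℝ EB] [TopologicalSpace HB]
    (IG : ModelWithCorners ℝ EG HG) (IE : ModelWithCorners ℝ EE HE)
    (IB : ModelWithCorners ℝ EB HB)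
    (G : Type*) {E B : Type*}
    [Group G] [TopologicalSpace G] [ChartedSpace HG G] [LieGroup IG ∞ G]
    [TopologicalSpace E] [ChartedSpace HE E] [IsManifold IE ∞ E]
    [TopologicalSpace B] [ChartedSpace HB B] [IsManifold IB ∞ B]
    [MulAction G E] (π : E → B) : Prop where
  contMDiff_smul : ContMDiff (IG.prod IE) IE ∞ (fun x : G × E => x.1 • x.2)
  contMDiff_proj : ContMDiff IE IB ∞ π
  proj_smul : ∀ (g : G) (x : E), π (g • x) = π x
  exists_trivialization : ∀ b : B, ∃ e : Bundle.Trivialization G π,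
    b ∈ e.baseSet ∧
    ContMDiffOn IE (IB.prod IG) ∞ e e.source ∧
    ContMDiffOn (IB.prod IG) IE ∞ e.toOpenPartialHomeomorph.symm e.target ∧
    ∀ (g : G), ∀ x ∈ e.source, (e (g • x)).2 = g * (e x).2

end AlgProj

/-! A point `u` is good exactly when some left-linear form `f : V → F` has `f u = 1`
(`IsGoodPoint.exists_form`, `isGoodPoint_of_isUnit_form`), and such forms carry the whole proof.
Freeness: `α • u = u` gives `α = f (α • u) = f u = 1`.

Where `f` takes unit values, `x ↦ f(x)⁻¹ x` picks the unique point of each orbit on the affine slice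
`f = 1`. This slice is a translate of `ker f`, a real space of dimension `dim V - dim F`, and
consists of good points. It therefore yields an affine chart onto all of `ℝ^d`
(`AffineSlice.chart`), and `x ↦ ([x], f x)` trivializes the quotient map over it.

Properness (`properSMul_units`): if `x → x₀` and `α x → y`, a form equal to `1` at `x₀` recovers `α
= f(α x) f(x)⁻¹ → f y`; a form `g` with `g y = 1` shows that this limit is a unit. The Hausdorff
property follows from properness. -/

namespace AlgProj

/-! ### Good points and linear forms -/

section

variable {F V : Type*} [Ring F] [AddCommGroup V] [Module F V]

theorem IsGoodPoint.exists_form {u : V} (hu : IsGoodPoint F u) :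
    ∃ f : V →ₗ[F] F, f u = 1 := by
  obtain ⟨n, b, h⟩ := hu
  obtain ⟨v, hv⟩ := h 1
  refine ⟨b.constr ℕ v, ?_⟩
  simpa [b.constr_apply_fintype ℕ] using hv

/-- Any basis works: if `∑ xᵢ f(bᵢ)` is a unit `w`, right multiplication by `w⁻¹ a` reaches every
`a`. -/
theorem isGoodPoint_of_isUnit_form [Module.Free F V] [Module.Finite F V]
    (f : V →ₗ[F] F) {x : V} (hx : IsUnit (f x)) : IsGoodPoint F x := by
  let b := (Module.Free.chooseBasis F V).reindex (Fintype.equivFin _)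
  obtain ⟨w, hw⟩ := hx
  have hsum : ∑ i, b.repr x i * f (b i) = w := by
    rw [hw]
    conv_rhs => rw [← b.sum_repr x, map_sum]
    simp
  refine ⟨_, b, fun a => ⟨fun i => f (b i) * ((w⁻¹ : Fˣ) * a), ?_⟩⟩
  simp only [← mul_assoc, ← Finset.sum_mul, hsum, Units.mul_inv, one_mul]

theorem exists_isGoodPoint [Module.Free F V] [Module.Finite F V] [Nontrivial V] :
    ∃ u : V, IsGoodPoint F u := by
  let b := Module.Free.chooseBasis F V
  obtain ⟨i⟩ := b.index_nonempty
  exact ⟨b i, isGoodPoint_of_isUnit_form (b.coord i) (by simp)⟩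

end

/-! ### Freeness, properness and smoothness of the action -/

section

variable {F V : Type*} [NormedRing F] [NormedAlgebra ℝ F] [NormedAddCommGroup V]
  [NormedSpace ℝ V] [Module F V] [IsScalarTower ℝ F V] [FiniteDimensional ℝ V]

/-- A left `F`-linear form, as a continuous real linear map. -/
noncomputable def formCLM (f : V →ₗ[F] F) : V →L[ℝ] F :=
  LinearMap.toContinuousLinearMap (f.restrictScalars ℝ)

theorem contDiff_form (f : V →ₗ[F] F) {n : WithTop ℕ∞} :
    ContDiff ℝ n f :=
  (formCLM f).contDiff

end

section

variable {F V : Type*} [NormedRing F] [NormedAlgebra ℝ F] [FiniteDimensional ℝ F]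
  [NormedAddCommGroup V] [NormedSpace ℝ V] [Module F V] [IsScalarTower ℝ F V]

/-- Finite dimension makes `F` Noetherian, and there one-sided inverses are two-sided. -/
theorem isUnit_of_mul_eq_one_of_finiteDimensional {a b : F} (h : a * b = 1) : IsUnit a := by
  have : IsNoetherianRing F := isNoetherian_of_tower ℝ inferInstance
  exact ⟨⟨a, b, h, mul_eq_one_symm h⟩, rfl⟩

theorem contDiff_algebra_smul [FiniteDimensional ℝ V] {n : WithTop ℕ∞} :
    ContDiff ℝ n (fun p : F × V => p.1 • p.2) := by
  let B : F →ₗ[ℝ] V →L[ℝ] V :=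
    LinearMap.toContinuousLinearMap.toLinearMap ∘ₗ (Algebra.lsmul ℝ ℝ V).toLinearMap
  let B' : F →L[ℝ] V →L[ℝ] V := LinearMap.toContinuousLinearMap B
  exact (B'.contDiff.comp contDiff_fst).clm_apply contDiff_snd

theorem continuous_algebra_smul [FiniteDimensional ℝ V] :
    Continuous (fun p : F × V => p.1 • p.2) :=
  (contDiff_algebra_smul (n := 0)).continuous

theorem units_smul_coe (α : Fˣ) (p : goodPoints F V) :
    ((α • p : goodPoints F V) : V) = (α : F) • (p : V) := rfl

theorem eq_one_of_smul_eq (α : Fˣ) (p : goodPoints F V) (h : α • p = p) : α = 1 := by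
  obtain ⟨f, hf⟩ := IsGoodPoint.exists_form p.2
  have := congrArg (fun q : goodPoints F V => f q) h
  simp only [units_smul_coe, map_smul, hf, smul_eq_mul, mul_one] at this
  exact Units.ext this

theorem continuous_units_smul [FiniteDimensional ℝ V] :
    Continuous (fun x : Fˣ × goodPoints F V => x.1 • x.2) :=
  Continuous.subtype_mk (continuous_algebra_smul.comp
    ((Units.continuous_val.comp continuous_fst).prodMk
      (continuous_subtype_val.comp continuous_snd))) _

open Filter Topology in
theorem properSMul_units [FiniteDimensional ℝ V] : ProperSMul Fˣ (goodPoints F V) := by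
  refine ⟨isProperMap_iff_ultrafilter.2
    ⟨continuous_units_smul.prodMk continuous_snd, ?_⟩⟩
  rintro 𝒰 ⟨y, x⟩ h
  have hy : Tendsto (fun p : Fˣ × goodPoints F V => (p.1 : F) • (p.2 : V)) 𝒰 (𝓝 (y : V)) :=
    (continuous_subtype_val.comp continuous_fst).continuousAt.tendsto.comp h
  have hx' : Tendsto (fun p : Fˣ × goodPoints F V => p.2) 𝒰 (𝓝 x) :=
    continuous_snd.continuousAt.tendsto.comp h
  have hx : Tendsto (fun p : Fˣ × goodPoints F V => (p.2 : V)) 𝒰 (𝓝 (x : V)) :=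
    continuous_subtype_val.continuousAt.tendsto.comp hx'
  obtain ⟨f, hf⟩ := IsGoodPoint.exists_form x.2
  obtain ⟨g, hg⟩ := IsGoodPoint.exists_form y.2
  have hfc : Continuous f := (formCLM f).continuous
  have hgc : Continuous g := (formCLM g).continuous
  -- Inversion is continuous at the unit `f x = 1`, although `Ring.inverse` is `0` at non-units.
  have hfx : Tendsto (fun p : Fˣ × goodPoints F V => Ring.inverse (f p.2)) 𝒰 (𝓝 1) := by
    have h1 : ContinuousAt Ring.inverse (f x) := by
      rw [hf]
      exact NormedRing.inverse_continuousAt (1 : Fˣ)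
    have := h1.tendsto.comp (hfc.continuousAt.tendsto.comp hx)
    rwa [hf, Ring.inverse_one] at this
  have hunit : ∀ᶠ p : Fˣ × goodPoints F V in 𝒰, IsUnit (f p.2) := by
    refine (hfc.continuousAt.tendsto.comp hx).eventually (Units.isOpen.mem_nhds ?_)
    rw [hf]
    exact isUnit_one
  -- Eventually `f p.2` is a unit, so `p.1 = f(p.1 • p.2) f(p.2)⁻¹`.
  have hα : Tendsto (fun p : Fˣ × goodPoints F V => (p.1 : F)) 𝒰 (𝓝 (f y)) := by
    have := (hfc.continuousAt.tendsto.comp hy).mul hfx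
    rw [mul_one] at this
    refine this.congr' ?_
    filter_upwards [hunit] with p hp
    simp [mul_assoc, Ring.mul_inverse_cancel _ hp]
  -- Both sides are limits of `p.1 * g p.2 = g (p.1 • p.2)`; this keeps the limit of the scalars
  -- inside the unit group.
  have hmul : f y * g x = 1 := by
    have h1 := hα.mul (hgc.continuousAt.tendsto.comp hx)
    have h2 := hgc.continuousAt.tendsto.comp hy
    rw [hg] at h2
    refine tendsto_nhds_unique h1 (h2.congr fun p => ?_)
    simp
  obtain ⟨α, hαy⟩ := isUnit_of_mul_eq_one_of_finiteDimensional hmul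
  refine ⟨(α, x), ?_, ?_⟩
  · refine Prod.ext (Subtype.ext ?_) rfl
    refine tendsto_nhds_unique ?_ hy
    have := continuous_algebra_smul.continuousAt.tendsto.comp (hα.prodMk_nhds hx)
    rwa [← hαy] at this
  · have hα' : Tendsto (fun p : Fˣ × goodPoints F V => p.1) 𝒰 (𝓝 α) := by
      rw [Units.isOpenEmbedding_val.tendsto_nhds_iff, hαy]
      exact hα
    exact tendsto_id'.1 (hα'.prodMk_nhds hx')

theorem continuousConstSMul_units [FiniteDimensional ℝ V] :
    ContinuousConstSMul Fˣ (goodPoints F V) :=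
  ⟨fun α => continuous_units_smul.comp (Continuous.prodMk_right α)⟩

theorem isOpenMap_proj [FiniteDimensional ℝ V] : IsOpenMap (proj F V) :=
  have : ContinuousConstSMul Fˣ (goodPoints F V) := continuousConstSMul_units
  isOpenMap_quotient_mk'_mul

theorem continuous_proj : Continuous (proj F V) := continuous_quot_mk

theorem proj_surjective : Function.Surjective (proj F V) := Quotient.mk_surjective

theorem proj_units_smul (α : Fˣ) (x : goodPoints F V) : proj F V (α • x) = proj F V x :=
  Quotient.sound ⟨α, rfl⟩

theorem contMDiff_units_smul [FiniteDimensional ℝ V] :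
    ContMDiff (𝓘(ℝ, F).prod 𝓘(ℝ, V)) 𝓘(ℝ, V) ∞
      (fun x : Fˣ × goodPoints F V => x.1 • x.2) := by
  rw [← ContMDiff.subtypeVal_comp_iff]
  exact contDiff_algebra_smul.comp_contMDiff
    ((Units.contMDiff_val.comp contMDiff_fst).prodMk_space
      (contMDiff_subtype_val.comp contMDiff_snd))

end

/-! ### Affine slices and affine charts -/

/-- An `F`-linear form on `V` together with a linear parametrization, by `ℝ^d`, of the affine
subspace on which the form takes the value `1`. This subspace is a slice for the action of `F^×`
on the set where the form is invertible. -/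
structure AffineSlice (F V : Type*) [NormedRing F] [NormedAddCommGroup V] [NormedSpace ℝ V]
    [Module F V] (d : ℕ) where
  form : V →ₗ[F] F
  base : V
  coord : V →L[ℝ] EuclideanSpace ℝ (Fin d)
  param : EuclideanSpace ℝ (Fin d) →L[ℝ] V
  form_base : form base = 1
  form_param : ∀ w, form (param w) = 0
  coord_param : ∀ w, coord (param w) = w
  param_coord : ∀ v, param (coord v) = v - form v • base

section

variable {F V : Type*} [NormedRing F] [NormedAlgebra ℝ F] [NormedAddCommGroup V]
  [NormedSpace ℝ V] [Module F V] [IsScalarTower ℝ F V] [FiniteDimensional ℝ V]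

theorem exists_affineSlice {d : ℕ} (hd : d + Module.finrank ℝ F = Module.finrank ℝ V)
    {u : V} (hu : IsGoodPoint F u) : ∃ S : AffineSlice F V d, S.form u = 1 := by
  obtain ⟨f, hf⟩ := hu.exists_form
  let fR : V →ₗ[ℝ] F := f.restrictScalars ℝ
  have hsurj : Function.Surjective fR := fun a => ⟨a • u, by simp [fR, hf]⟩
  have hker : Module.finrank ℝ (LinearMap.ker fR) = Module.finrank ℝ (EuclideanSpace ℝ (Fin d)) := by
    have := fR.finrank_range_add_finrank_ker
    rw [LinearMap.range_eq_top.2 hsurj, finrank_top] at this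
    rw [finrank_euclideanSpace_fin]
    omega
  let L := LinearEquiv.ofFinrankEq _ _ hker
  -- The projection onto `ker f` along `F u`; by rank-nullity `ker f` has real dimension `d`.
  let P : V →ₗ[ℝ] LinearMap.ker fR := LinearMap.codRestrict _
    (LinearMap.id - ((LinearMap.toSpanSingleton F V u).restrictScalars ℝ) ∘ₗ fR)
    (fun v => by simp [fR, hf])
  have hP : ∀ v, (P v : V) = v - f v • u := fun v => rfl
  refine ⟨{ form := f, base := u, coord := LinearMap.toContinuousLinearMap (L.toLinearMap ∘ₗ P),
            param := LinearMap.toContinuousLinearMap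
              ((LinearMap.ker fR).subtype ∘ₗ L.symm.toLinearMap)
            form_base := hf
            form_param := fun w => (L.symm w).2
            coord_param := fun w => ?_
            param_coord := fun v => ?_ }, hf⟩
  · have h0 : f (L.symm w) = 0 := (L.symm w).2
    have : P (L.symm w) = L.symm w := Subtype.ext (by rw [hP, h0]; simp)
    simp [this]
  · simp [hP]

end

namespace AffineSlice

section

variable {F V : Type*} [NormedRing F] [NormedAddCommGroup V] [NormedSpace ℝ V]
    [Module F V] {d : ℕ} (S : AffineSlice F V d)

theorem coord_base : S.coord S.base = 0 := by
  have h := S.param_coord S.base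
  rw [S.form_base, one_smul, sub_self] at h
  rw [← S.coord_param (S.coord S.base), h, map_zero]

theorem form_base_add_param (w : EuclideanSpace ℝ (Fin d)) :
    S.form (S.base + S.param w) = 1 := by
  rw [map_add, S.form_base, S.form_param, add_zero]

/-- The affine coordinate `coord (f(x)⁻¹ x)` of a vector `x`, where `f` is the form. -/
noncomputable def affineCoord (x : V) : EuclideanSpace ℝ (Fin d) :=
  S.coord (Ring.inverse (S.form x) • x)

theorem contDiff_base_add_param {n : WithTop ℕ∞} :
    ContDiff ℝ n (fun w => S.base + S.param w) :=
  contDiff_const.add S.param.contDiff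

theorem affineCoord_base_add_param (w : EuclideanSpace ℝ (Fin d)) :
    S.affineCoord (S.base + S.param w) = w := by
  rw [affineCoord, S.form_base_add_param, Ring.inverse_one, one_smul, map_add, S.coord_base,
    zero_add, S.coord_param]

theorem base_add_param_affineCoord {x : V} (hx : IsUnit (S.form x)) :
    S.base + S.param (S.affineCoord x) = Ring.inverse (S.form x) • x := by
  rw [affineCoord, S.param_coord, map_smul, smul_eq_mul, Ring.inverse_mul_cancel _ hx, one_smul,
    add_sub_cancel]

theorem isUnit_form_units_smul_iff (α : Fˣ) (x : V) :
    IsUnit (S.form ((α : F) • x)) ↔ IsUnit (S.form x) := by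
  rw [map_smul, smul_eq_mul, Units.isUnit_units_mul]

/-- On units, `(α β)⁻¹ α = β⁻¹`. Elsewhere `Ring.inverse` is `0` on both sides, so invariance needs
no domain condition and the coordinate descends to the whole quotient. -/
theorem affineCoord_units_smul (α : Fˣ) (x : V) :
    S.affineCoord ((α : F) • x) = S.affineCoord x := by
  have h := S.isUnit_form_units_smul_iff α x
  by_cases hx : IsUnit (S.form x)
  · rw [affineCoord, affineCoord, map_smul S.form, smul_eq_mul]
    obtain ⟨β, hβ⟩ := hx
    rw [← hβ, ← Units.val_mul, Ring.inverse_unit, Ring.inverse_unit, smul_smul, mul_inv_rev]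
    simp
  · rw [affineCoord, affineCoord, Ring.inverse_non_unit _ hx,
      Ring.inverse_non_unit _ (fun h' => hx (h.1 h')), zero_smul, zero_smul]

end

section

variable {F V : Type*} [NormedRing F] [NormedAlgebra ℝ F] [FiniteDimensional ℝ F]
  [NormedAddCommGroup V] [NormedSpace ℝ V] [Module F V] [IsScalarTower ℝ F V]
  {d : ℕ} (S : AffineSlice F V d)

theorem contDiffAt_affineCoord [FiniteDimensional ℝ V] {x : V} (hx : IsUnit (S.form x))
    {n : WithTop ℕ∞} :
    ContDiffAt ℝ n S.affineCoord x := by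
  obtain ⟨α, hα⟩ := hx
  have h1 : ContDiffAt ℝ n Ring.inverse (S.form x) := hα ▸ contDiffAt_ringInverse ℝ α
  have h2 : ContDiffAt ℝ n (fun y => Ring.inverse (S.form y)) x :=
    h1.comp x (contDiff_form S.form).contDiffAt
  exact S.coord.contDiff.contDiffAt.comp x
    (contDiff_algebra_smul.contDiffAt.comp x (h2.prodMk contDiffAt_id))

/-- The set of points of projective space at which the form is invertible. -/
def domain : Set (ProjSpace F V) :=
  {q | Quotient.liftOn q (fun x : goodPoints F V => IsUnit (S.form x)) (by
    rintro _ x ⟨α, rfl⟩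
    exact propext (S.isUnit_form_units_smul_iff α x))}

theorem proj_mem_domain {x : goodPoints F V} :
    proj F V x ∈ S.domain ↔ IsUnit (S.form x) := Iff.rfl

/-- The affine coordinate, as a function on projective space. -/
noncomputable def chartFun (q : ProjSpace F V) : EuclideanSpace ℝ (Fin d) :=
  Quotient.liftOn q (fun x : goodPoints F V => S.affineCoord x) (by
    rintro _ x ⟨α, rfl⟩
    exact S.affineCoord_units_smul α x)

theorem chartFun_proj (x : goodPoints F V) : S.chartFun (proj F V x) = S.affineCoord x := rfl

section

variable [Module.Free F V] [Module.Finite F V]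

/-- The parametrization of the slice, with values in the good points. -/
def slicePoint (w : EuclideanSpace ℝ (Fin d)) : goodPoints F V :=
  ⟨S.base + S.param w, isGoodPoint_of_isUnit_form S.form
    (by rw [S.form_base_add_param]; exact isUnit_one)⟩

theorem coe_slicePoint (w : EuclideanSpace ℝ (Fin d)) :
    (S.slicePoint w : V) = S.base + S.param w := rfl

theorem contMDiff_slicePoint : ContMDiff (𝓡 d) 𝓘(ℝ, V) ∞ S.slicePoint := by
  rw [← ContMDiff.subtypeVal_comp_iff]
  exact S.contDiff_base_add_param.contMDiff

theorem form_slicePoint (w : EuclideanSpace ℝ (Fin d)) : S.form (S.slicePoint w) = 1 :=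
  S.form_base_add_param w

/-- The slice point with the coordinates of `x` lies in the orbit of `x`; this gives the left
inverse law of both the chart and the trivialization. -/
theorem slicePoint_affineCoord {x : goodPoints F V} (α : Fˣ) (h : S.form x = α) :
    S.slicePoint (S.affineCoord x) = α⁻¹ • x := by
  refine Subtype.ext ?_
  rw [coe_slicePoint, S.base_add_param_affineCoord (h ▸ α.isUnit), h, Ring.inverse_unit,
    units_smul_coe]

variable [FiniteDimensional ℝ V]

/-- The affine chart of projective space given by a slice. -/
noncomputable def chart :
    OpenPartialHomeomorph (ProjSpace F V) (EuclideanSpace ℝ (Fin d)) where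
  toFun := S.chartFun
  invFun w := proj F V (S.slicePoint w)
  source := S.domain
  target := Set.univ
  map_source' _ _ := Set.mem_univ _
  map_target' w _ := by
    rw [proj_mem_domain, form_slicePoint]
    exact isUnit_one
  left_inv' q hq := by
    obtain ⟨x, rfl⟩ := proj_surjective q
    obtain ⟨α, hα⟩ := S.proj_mem_domain.1 hq
    rw [chartFun_proj, S.slicePoint_affineCoord α hα.symm, proj_units_smul]
  right_inv' w _ := S.affineCoord_base_add_param w
  open_source := by
    have : S.domain = proj F V '' {x | IsUnit (S.form x)} := by
      refine (Set.image_preimage_eq S.domain proj_surjective).symm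
    rw [this]
    exact isOpenMap_proj _ (Units.isOpen.preimage
      ((contDiff_form (n := 0) S.form).continuous.comp continuous_subtype_val))
  open_target := isOpen_univ
  continuousOn_toFun q hq := by
    obtain ⟨x, rfl⟩ := proj_surjective q
    refine ContinuousAt.continuousWithinAt ?_
    have hx : ContinuousAt (S.chartFun ∘ proj F V) x :=
      ContinuousAt.comp (f := Subtype.val) (S.contDiffAt_affineCoord (n := 0) hq).continuousAt
        continuous_subtype_val.continuousAt
    -- Since the quotient map is open, continuity can be checked upstairs on `V^•`.
    intro s hs
    have := isOpenMap_proj.image_mem_nhds (hx hs)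
    refine Filter.mem_map.2 (Filter.mem_of_superset this ?_)
    rintro _ ⟨y, hy, rfl⟩
    exact hy
  continuousOn_invFun :=
    (continuous_proj.comp S.contMDiff_slicePoint.continuous).continuousOn

theorem chart_symm_apply (w : EuclideanSpace ℝ (Fin d)) :
    S.chart.symm w = proj F V (S.slicePoint w) := rfl

end

end

end AffineSlice

/-! ### The smooth atlas -/

section

variable {F V : Type*} [NormedRing F] [NormedAlgebra ℝ F] [FiniteDimensional ℝ F]
  [NormedAddCommGroup V] [NormedSpace ℝ V] [Module F V] [IsScalarTower ℝ F V]
  [FiniteDimensional ℝ V] {d : ℕ}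

theorem AffineSlice.exists_mem_domain (hd : d + Module.finrank ℝ F = Module.finrank ℝ V)
    (q : ProjSpace F V) : ∃ S : AffineSlice F V d, q ∈ S.domain := by
  obtain ⟨x, rfl⟩ := proj_surjective q
  obtain ⟨S, hS⟩ := exists_affineSlice hd x.2
  exact ⟨S, S.proj_mem_domain.2 (hS ▸ isUnit_one)⟩

variable [Module.Free F V] [Module.Finite F V]

/-- The atlas of projective space consisting of all affine charts. -/
@[reducible] noncomputable def chartedSpaceProjSpace
    (hd : d + Module.finrank ℝ F = Module.finrank ℝ V) :
    ChartedSpace (EuclideanSpace ℝ (Fin d)) (ProjSpace F V) where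
  atlas := {e | ∃ S : AffineSlice F V d, S.chart = e}
  chartAt q := (AffineSlice.exists_mem_domain hd q).choose.chart
  mem_chart_source q := (AffineSlice.exists_mem_domain hd q).choose_spec
  chart_mem_atlas _ := ⟨_, rfl⟩

theorem isManifold_projSpace (hd : d + Module.finrank ℝ F = Module.finrank ℝ V) :
    @IsManifold ℝ _ _ _ _ _ _ (𝓡 d) ∞ (ProjSpace F V) _ (chartedSpaceProjSpace hd) := by
  let := chartedSpaceProjSpace (F := F) (V := V) hd
  refine isManifold_of_contDiffOn _ _ _ ?_
  rintro _ _ ⟨S, rfl⟩ ⟨T, rfl⟩ w ⟨hw, -⟩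
  -- The transition map sends `w` to the `T`-coordinate of the `S`-slice point, which is smooth
  -- where `T.form` is a unit.
  have hw' : IsUnit (T.form (S.base + S.param w)) := hw.2
  exact ((T.contDiffAt_affineCoord hw').comp w
    S.contDiff_base_add_param.contDiffAt).contDiffWithinAt

end

/-! ### Local trivializations -/

namespace AffineSlice

section

variable {F V : Type*} [NormedRing F] [NormedAlgebra ℝ F] [FiniteDimensional ℝ F]
  [NormedAddCommGroup V] [NormedSpace ℝ V] [Module F V] [IsScalarTower ℝ F V]
  {d : ℕ} (S : AffineSlice F V d)

open Classical in
/-- The value of the form, as a unit, with junk value `1` where it is not invertible. -/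
noncomputable def unitForm (x : goodPoints F V) : Fˣ :=
  if h : IsUnit (S.form x) then h.unit else 1

theorem unitForm_eq {x : goodPoints F V} {α : Fˣ} (h : S.form x = α) : S.unitForm x = α := by
  have h' : IsUnit (S.form x) := h ▸ α.isUnit
  rw [unitForm, dif_pos h']
  exact Units.ext h

theorem form_eq_unitForm {x : goodPoints F V} (h : IsUnit (S.form x)) :
    S.form x = S.unitForm x := by
  obtain ⟨α, hα⟩ := h
  rw [S.unitForm_eq hα.symm, hα]

theorem unitForm_units_smul (α : Fˣ) {x : goodPoints F V} (h : IsUnit (S.form x)) :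
    S.unitForm (α • x) = α * S.unitForm x := by
  refine S.unitForm_eq ?_
  rw [units_smul_coe, map_smul, smul_eq_mul, Units.val_mul, S.form_eq_unitForm h]

variable [FiniteDimensional ℝ V]

theorem contMDiffOn_affineCoord :
    ContMDiffOn 𝓘(ℝ, V) (𝓡 d) ∞ (fun x : goodPoints F V => S.affineCoord x)
      (proj F V ⁻¹' S.domain) := fun x hx =>
  (ContMDiffAt.comp x (S.contDiffAt_affineCoord (x := (x : V)) hx).contMDiffAt
    contMDiff_subtype_val.contMDiffAt).contMDiffWithinAt

/-- The smooth structure of `Fˣ` comes from its open embedding in `F`, so smoothness passes from the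
form to its unit-valued lift through the inverse of that embedding. -/
theorem contMDiffOn_unitForm :
    ContMDiffOn 𝓘(ℝ, V) 𝓘(ℝ, F) ∞ S.unitForm (proj F V ⁻¹' S.domain) := by
  have h := contMDiffOn_isOpenEmbedding_symm (I := 𝓘(ℝ, F)) (n := ∞)
    (Units.isOpenEmbedding_val (R := F))
  have hf : ContMDiffOn 𝓘(ℝ, V) 𝓘(ℝ, F) ∞ (fun x : goodPoints F V => S.form x)
      (proj F V ⁻¹' S.domain) :=
    ((contDiff_form S.form).contMDiff.comp contMDiff_subtype_val).contMDiffOn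
  refine (h.comp hf fun x hx => ?_).congr fun x hx => ?_
  · exact ⟨S.unitForm x, (S.form_eq_unitForm hx).symm⟩
  · have hx' : S.form x = S.unitForm x := S.form_eq_unitForm hx
    rw [Function.comp_apply, hx']
    exact (Topology.IsOpenEmbedding.toOpenPartialHomeomorph_left_inv _
      Units.isOpenEmbedding_val).symm

variable [Module.Free F V] [Module.Finite F V]
  (hd : d + Module.finrank ℝ F = Module.finrank ℝ V)

theorem contMDiffOn_chart :
    letI := chartedSpaceProjSpace (F := F) (V := V) hd
    ContMDiffOn (𝓡 d) (𝓡 d) ∞ S.chart S.domain := by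
  let := chartedSpaceProjSpace (F := F) (V := V) hd
  have := isManifold_projSpace (F := F) (V := V) hd
  exact contMDiffOn_of_mem_maximalAtlas
    (IsManifold.subset_maximalAtlas ⟨S, rfl⟩)

theorem contMDiff_chart_symm :
    letI := chartedSpaceProjSpace (F := F) (V := V) hd
    ContMDiff (𝓡 d) (𝓡 d) ∞ S.chart.symm := by
  let := chartedSpaceProjSpace (F := F) (V := V) hd
  have := isManifold_projSpace (F := F) (V := V) hd
  exact contMDiffOn_univ.1 (contMDiffOn_symm_of_mem_maximalAtlas
    (IsManifold.subset_maximalAtlas ⟨S, rfl⟩))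

/-- Over the chart domain, the quotient map is the inverse chart composed with the affine
coordinate. -/
theorem contMDiffOn_proj :
    letI := chartedSpaceProjSpace (F := F) (V := V) hd
    ContMDiffOn 𝓘(ℝ, V) (𝓡 d) ∞ (proj F V) (proj F V ⁻¹' S.domain) := by
  let := chartedSpaceProjSpace (F := F) (V := V) hd
  refine ((S.contMDiff_chart_symm hd).comp_contMDiffOn S.contMDiffOn_affineCoord).congr ?_
  intro x hx
  exact (S.chart.left_inv hx).symm

/-- The inverse of the local trivialization over the domain of an affine chart. -/
noncomputable def trivializationInv (p : ProjSpace F V × Fˣ) : goodPoints F V :=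
  p.2 • S.slicePoint (S.chart p.1)

theorem contMDiffOn_trivializationInv :
    letI := chartedSpaceProjSpace (F := F) (V := V) hd
    ContMDiffOn ((𝓡 d).prod 𝓘(ℝ, F)) 𝓘(ℝ, V) ∞ S.trivializationInv
      (S.domain ×ˢ Set.univ) := by
  let := chartedSpaceProjSpace (F := F) (V := V) hd
  refine contMDiff_units_smul.comp_contMDiffOn (contMDiffOn_snd.prodMk ?_)
  exact S.contMDiff_slicePoint.comp_contMDiffOn
    ((S.contMDiffOn_chart hd).comp contMDiffOn_fst fun p hp => hp.1)

theorem contMDiffOn_proj_unitForm :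
    letI := chartedSpaceProjSpace (F := F) (V := V) hd
    ContMDiffOn 𝓘(ℝ, V) ((𝓡 d).prod 𝓘(ℝ, F)) ∞ (fun x => (proj F V x, S.unitForm x))
      (proj F V ⁻¹' S.domain) :=
  let := chartedSpaceProjSpace (F := F) (V := V) hd
  (S.contMDiffOn_proj hd).prodMk S.contMDiffOn_unitForm

theorem proj_trivializationInv {p : ProjSpace F V × Fˣ} (hp : p.1 ∈ S.domain) :
    proj F V (S.trivializationInv p) = p.1 := by
  rw [trivializationInv, proj_units_smul, ← S.chart_symm_apply]
  exact S.chart.left_inv hp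

/-- The local trivialization over the domain of an affine chart. -/
noncomputable def trivialization : Bundle.Trivialization Fˣ (proj F V) where
  toFun x := (proj F V x, S.unitForm x)
  invFun := S.trivializationInv
  source := proj F V ⁻¹' S.domain
  target := S.domain ×ˢ Set.univ
  map_source' _ hx := ⟨hx, Set.mem_univ _⟩
  map_target' p hp := by
    rw [Set.mem_preimage, S.proj_trivializationInv hp.1]
    exact hp.1
  left_inv' x hx := by
    change S.unitForm x • S.slicePoint (S.affineCoord x) = x
    rw [S.slicePoint_affineCoord _ (S.form_eq_unitForm hx), smul_inv_smul]
  right_inv' p hp := by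
    refine Prod.ext (S.proj_trivializationInv hp.1) (S.unitForm_eq ?_)
    rw [trivializationInv, units_smul_coe, map_smul, form_slicePoint, smul_eq_mul, mul_one]
  open_source := S.chart.open_source.preimage continuous_proj
  open_target := S.chart.open_source.prod isOpen_univ
  continuousOn_toFun :=
    letI := chartedSpaceProjSpace (F := F) (V := V) hd
    (S.contMDiffOn_proj_unitForm hd).continuousOn
  continuousOn_invFun :=
    letI := chartedSpaceProjSpace (F := F) (V := V) hd
    (S.contMDiffOn_trivializationInv hd).continuousOn
  baseSet := S.domain
  open_baseSet := S.chart.open_source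
  source_eq := rfl
  target_eq := rfl
  proj_toFun _ _ := rfl

end

end AffineSlice

/-! ### The principal bundle and the dimension -/

section

variable {F V : Type*} [NormedRing F] [NormedAlgebra ℝ F] [FiniteDimensional ℝ F]
  [NormedAddCommGroup V] [NormedSpace ℝ V] [Module F V] [IsScalarTower ℝ F V]
  [FiniteDimensional ℝ V] [Module.Free F V] [Module.Finite F V] {d : ℕ}

theorem isSmoothPrincipalBundle_proj (hd : d + Module.finrank ℝ F = Module.finrank ℝ V) :
    letI := chartedSpaceProjSpace (F := F) (V := V) hd
    haveI := isManifold_projSpace (F := F) (V := V) hd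
    IsSmoothPrincipalBundle 𝓘(ℝ, F) 𝓘(ℝ, V) (𝓡 d) Fˣ (proj F V) := by
  let := chartedSpaceProjSpace (F := F) (V := V) hd
  have := isManifold_projSpace (F := F) (V := V) hd
  refine ⟨contMDiff_units_smul, fun x => ?_, proj_units_smul, fun q => ?_⟩
  · obtain ⟨S, hS⟩ := AffineSlice.exists_mem_domain hd (proj F V x)
    exact (S.contMDiffOn_proj hd).contMDiffAt
      ((S.chart.open_source.preimage continuous_proj).mem_nhds hS)
  · obtain ⟨S, hS⟩ := AffineSlice.exists_mem_domain hd q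
    exact ⟨S.trivialization hd, hS, S.contMDiffOn_proj_unitForm hd,
      S.contMDiffOn_trivializationInv hd, fun α x hx => S.unitForm_units_smul α hx⟩

end

section

variable {F V : Type*} [NormedRing F] [NormedAlgebra ℝ F] [NormedAddCommGroup V]
  [NormedSpace ℝ V] [Module F V] [IsScalarTower ℝ F V] [FiniteDimensional ℝ V]
  [Module.Free F V] [Module.Finite F V]

/-- A form with value `1` at a good point is surjective, so `dim F ≤ dim V`; a good point exists
because `V ≠ 0`. -/
theorem exists_add_finrank_eq_finrank [Nontrivial V] :
    ∃ d : ℕ, d + Module.finrank ℝ F = Module.finrank ℝ V := by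
  obtain ⟨u, hu⟩ := exists_isGoodPoint (F := F) (V := V)
  obtain ⟨f, hf⟩ := hu.exists_form
  have hsurj : Function.Surjective (f.restrictScalars ℝ) := fun a => ⟨a • u, by simp [hf]⟩
  obtain ⟨d, hd⟩ := Nat.exists_eq_add_of_le' (LinearMap.finrank_le_finrank_of_surjective hsurj)
  exact ⟨d, hd.symm⟩

end

end AlgProj

theorem mainTheorem2
    (F V : Type*) [NormedRing F] [NormedAlgebra ℝ F] [FiniteDimensional ℝ F]
    [NormedAddCommGroup V] [NormedSpace ℝ V] [Module F V] [IsScalarTower ℝ F V]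
    [Module.Free F V] [Module.Finite F V] [Nontrivial V] :
    -- the action of `F^×` on `V^•` is free
    (∀ (α : Fˣ) (p : AlgProj.goodPoints F V), α • p = p → α = 1) ∧
    -- the action of `F^×` on `V^•` is proper
    ProperSMul Fˣ (AlgProj.goodPoints F V) ∧
    -- `P_F(V)` is Hausdorff and second countable
    T2Space (AlgProj.ProjSpace F V) ∧
    SecondCountableTopology (AlgProj.ProjSpace F V) ∧
    -- `P_F(V)` has a smooth structure of dimension `d = dim_ℝ V - dim_ℝ F` for which the
    -- quotient map `V^• → P_F(V)` is a smooth principal `F^×`-bundle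
    ∃ d : ℕ, d + Module.finrank ℝ F = Module.finrank ℝ V ∧
      ∃ (_ : ChartedSpace (EuclideanSpace ℝ (Fin d)) (AlgProj.ProjSpace F V))
        (_ : IsManifold (𝓡 d) ∞ (AlgProj.ProjSpace F V)),
        AlgProj.IsSmoothPrincipalBundle 𝓘(ℝ, F) 𝓘(ℝ, V) (𝓡 d) Fˣ (AlgProj.proj F V) := by
  have : FiniteDimensional ℝ V := Module.Finite.trans F V
  have hproper : ProperSMul Fˣ (AlgProj.goodPoints F V) := AlgProj.properSMul_units
  have : ContinuousConstSMul Fˣ (AlgProj.goodPoints F V) := AlgProj.continuousConstSMul_units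
  have : SecondCountableTopology V := secondCountable_of_proper
  obtain ⟨d, hd⟩ := AlgProj.exists_add_finrank_eq_finrank (F := F) (V := V)
  -- The quotient by a proper action is Hausdorff, and second countability passes to the quotient
  -- because the quotient map is open.
  exact ⟨AlgProj.eq_one_of_smul_eq, hproper, inferInstance,
    ContinuousConstSMul.secondCountableTopology, d, hd, AlgProj.chartedSpaceProjSpace hd,
    AlgProj.isManifold_projSpace hd, AlgProj.isSmoothPrincipalBundle_proj hd⟩
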